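/- Let $\mathbb K$ be $\mathbb R$ or $\mathbb C$; Banach spaces are over $\mathbb K$ and operators are bounded linear maps between them. Let $E$ be a Banach space, $K\subseteq E^*$ a $w^*$-compact set and $\varepsilon>0$. Put $$s_\varepsilon(K)=\{x\in K : \operatorname{diam}(K\cap V)>\varepsilon \text{ for every } w^*\text{-open } V\ni x\},$$ where the diameter is taken in the norm, and set $s^0_\varepsilon(K)=K$, $s^{\beta+1}_\varepsilon(K)=s_\varepsilon(s^\beta_\varepsilon(K))$, and $s^\beta_\varepsilon(K)=\bigcap_{\gamma<\beta}s^\gamma_\varepsilon(K)$ for $\beta$ a limit ordinal. The $\varepsilon$-Szlenk index $\mathrm{Sz}_\varepsilon(K)$ is the class of all ordinals $\beta$ with $s^\beta_\varepsilon(K)\neq\emptyset$ (it is an ordinal, or the class of all ordinals, in which case it is regarded as $\infty$), and $\mathrm{Sz}(K)=\bigcup_{\varepsilon>0}\mathrm{Sz}_\varepsilon(K)$. With $B_X$ the closed unit ball of $X$, put $\mathrm{Sz}(E)=\mathrm{Sz}(B_{E^*})$ for a Banach space $E$, and $\mathrm{Sz}(T)=\mathrm{Sz}(T^*B_{F^*})$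 for an operator $T:E\to F$. For an ordinal $\alpha$, let $\mathscr{SZ}_\alpha$ be the class of all operators $T$ between Banach spaces with $\mathrm{Sz}(T)\le\omega^\alpha$. A class $\mathscr I$ of operators has the factorization property if every $T\in\mathscr I$ can be written $T=BA$ with operators $A:E\to G$ and $B:G\to F$, where $G$ is a Banach space whose identity operator belongs to $\mathscr I$. **Corollary.** Let $\alpha$ be an ordinal of uncountable cofinality. Then $\mathscr{SZ}_\alpha$ has the factorization property. In other words, every $T\in\mathscr{SZ}_\alpha$ factors, via bounded linear operators, through a Banach space $G$ with $\mathrm{Sz}(G)\le\omega^\alpha$. -/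

import Mathlib

open scoped Ordinal Cardinal

universe u v

noncomputable section

/-- The Szlenk derivation `s_ε(K)` of a set `K` of functionals: those `x ∈ K` such that
`K ∩ V` has norm diameter `> ε` for every weak* open `V` containing `x`. -/
def szlenkDerivation {𝕜 : Type v} [RCLike 𝕜] {E : Type u} [NormedAddCommGroup E]
    [NormedSpace 𝕜 E] (ε : ℝ) (K : Set (StrongDual 𝕜 E)) : Set (StrongDual 𝕜 E) :=
  {x ∈ K | ∀ V : Set (WeakDual 𝕜 E), IsOpen V → StrongDual.toWeakDual x ∈ V →
    ENNReal.ofReal ε < Metric.ediam (K ∩ StrongDual.toWeakDual ⁻¹' V)}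

/-- The transfinite iterates `s_ε^β(K)`: `K` at `0`, `s_ε(s_ε^β(K))` at `β + 1`, and the
intersection of all earlier iterates at a limit ordinal. -/
def szlenkIterate {𝕜 : Type v} [RCLike 𝕜] {E : Type u} [NormedAddCommGroup E]
    [NormedSpace 𝕜 E] (ε : ℝ) (K : Set (StrongDual 𝕜 E)) (β : Ordinal.{u}) :
    Set (StrongDual 𝕜 E) :=
  Ordinal.limitRecOn β K (fun _ S => szlenkDerivation ε S)
    (fun γ _ S => ⋂ (δ : Ordinal.{u}) (h : δ < γ), S δ h)

/-- The `ε`-Szlenk index of `K`: the ordinal, or `⊤` (for `∞`), whose predecessors are the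
ordinals `β` with `s_ε^β(K) ≠ ∅`. -/
def epsSzlenkIndex {𝕜 : Type v} [RCLike 𝕜] {E : Type u} [NormedAddCommGroup E]
    [NormedSpace 𝕜 E] (ε : ℝ) (K : Set (StrongDual 𝕜 E)) : WithTop Ordinal.{u} :=
  ⨆ (β : Ordinal.{u}) (_ : (szlenkIterate ε K β).Nonempty), ((β + 1 : Ordinal.{u}) : WithTop _)

/-- The Szlenk index of `K`: the union (that is, the supremum) of the `ε`-Szlenk indices. -/
def szlenkIndex {𝕜 : Type v} [RCLike 𝕜] {E : Type u} [NormedAddCommGroup E]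
    [NormedSpace 𝕜 E] (K : Set (StrongDual 𝕜 E)) : WithTop Ordinal.{u} :=
  ⨆ (ε : ℝ) (_ : 0 < ε), epsSzlenkIndex ε K

/-- The Szlenk index of a normed space: that of the closed unit ball of its dual. -/
def spaceSzlenkIndex (𝕜 : Type v) [RCLike 𝕜] (E : Type u) [NormedAddCommGroup E]
    [NormedSpace 𝕜 E] : WithTop Ordinal.{u} :=
  szlenkIndex (Metric.closedBall (0 : StrongDual 𝕜 E) 1)

/-- The Szlenk index of an operator `T : E → F`: that of the image under the adjoint
`T* f = f ∘ T` of the closed unit ball of the dual of `F`. -/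
def operatorSzlenkIndex {𝕜 : Type v} [RCLike 𝕜] {E F : Type u} [NormedAddCommGroup E]
    [NormedSpace 𝕜 E] [NormedAddCommGroup F] [NormedSpace 𝕜 F] (T : E →L[𝕜] F) :
    WithTop Ordinal.{u} :=
  szlenkIndex ((fun f : StrongDual 𝕜 F => f.comp T) '' Metric.closedBall 0 1)

/-- A class of operators between Banach spaces over `𝕜`. -/
def OperatorClass (𝕜 : Type v) [RCLike 𝕜] : Type (max (u + 1) v) :=
  ∀ (E F : Type u) [NormedAddCommGroup E] [NormedSpace 𝕜 E] [CompleteSpace E]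
    [NormedAddCommGroup F] [NormedSpace 𝕜 F] [CompleteSpace F], (E →L[𝕜] F) → Prop

/-- A class of Banach spaces over `𝕜`. -/
def SpaceClass (𝕜 : Type v) [RCLike 𝕜] : Type (max (u + 1) v) :=
  ∀ (E : Type u) [NormedAddCommGroup E] [NormedSpace 𝕜 E] [CompleteSpace E], Prop

/-- `Space(I)`: the Banach spaces whose identity operator belongs to `I`. -/
def OperatorClass.spaces {𝕜 : Type v} [RCLike 𝕜] (I : OperatorClass.{u} 𝕜) :
    SpaceClass.{u} 𝕜 :=
  fun E _ _ _ => I E E (ContinuousLinearMap.id 𝕜 E)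

/-- `Op(S)`: the operators that factor, continuously and linearly, through a Banach space
in `S`. -/
def SpaceClass.operators {𝕜 : Type v} [RCLike 𝕜] (S : SpaceClass.{u} 𝕜) :
    OperatorClass.{u} 𝕜 :=
  fun E F _ _ _ _ _ _ T =>
    ∃ (G : Type u) (_ : NormedAddCommGroup G) (_ : NormedSpace 𝕜 G) (_ : CompleteSpace G)
      (A : E →L[𝕜] G) (B : G →L[𝕜] F), S G ∧ T = B.comp A

/-- `I` has the `J`-factorization property if `I ⊆ Op(Space(J))`. -/
def OperatorClass.HasFactorizationPropertyFor {𝕜 : Type v} [RCLike 𝕜]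
    (I J : OperatorClass.{u} 𝕜) : Prop :=
  ∀ (E F : Type u) [NormedAddCommGroup E] [NormedSpace 𝕜 E] [CompleteSpace E]
    [NormedAddCommGroup F] [NormedSpace 𝕜 F] [CompleteSpace F] (T : E →L[𝕜] F),
    I E F T → J.spaces.operators E F T

/-- `I` has the factorization property if it has the `I`-factorization property. -/
def OperatorClass.HasFactorizationProperty {𝕜 : Type v} [RCLike 𝕜]
    (I : OperatorClass.{u} 𝕜) : Prop :=
  I.HasFactorizationPropertyFor I

/-- The class of `α`-Szlenk operators: those of Szlenk index at most `ω ^ α`. -/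
def szlenkOperators (𝕜 : Type v) [RCLike 𝕜] (α : Ordinal.{u}) : OperatorClass.{u} 𝕜 :=
  fun _ _ _ _ _ _ _ _ T => operatorSzlenkIndex T ≤ ((ω ^ α : Ordinal.{u}) : WithTop _)

end

/-!
The proof factors `T : E → F` through its Davis–Figiel–Johnson–Pełczyński interpolation space `G`
(`interpolationSpace T`), with inclusion `J : G → F`, and has two parts.

Ordinals. The `ε`-Szlenk index of the weak* compact set `T* B_{F*}` is not a limit ordinal, so it
lies strictly below the limit ordinal `ω ^ α`. The Szlenk index is the supremum of the
`ε`-indices for `ε = 1 / (n + 1)`, and `α` has uncountable cofinality, so the index of `T` is at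
most `ω ^ γ` for some `γ < α` (`exists_lt_szlenkIndex_le_omega0_opow`). It is therefore enough that
the index of `G` is at most `ω ^ (γ + 1)` (`spaceSzlenkIndex_interpolationSpace_le`).

Interpolation. Let `σ = ω ^ γ`, so that `σ` steps exhaust every `δ`-derivation of `T* B_{F*}`. Take
`h` in the dual ball of `G` and in the slice `Re h(g) > 1 - c`, where `‖g‖ ≤ 1`. As `G` carries an
`ℓ²` norm, the tail of the coordinates of `g` is negligible and the first coordinates of `x` are
controlled by `‖J x‖`; comparing `Re h(g + t x)` with `‖g + t x‖` gives
`|h(x)| ≤ M ‖J x‖ + r ‖x‖` with `r` small and `M` depending on `g`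
(`IsSmoothInterpolation.exists_norm_apply_le_of_mem_slice`). By Hahn–Banach, the slice lies in
`M J* B_{F*} + r B_{G*}`. On bounded sets of functionals `f`, `‖J* f‖` is small once `‖T* f‖` is, so
the derivations of this set are dominated by those of `T* B_{F*}`
(`szlenkIterate_range_subset`), and `σ` steps of the `ε`-derivation exhaust it, whatever `M` is.
Since derivations are weak* local, `σ` steps remove every such slice: they shrink the dual ball,
and likewise every smaller ball, by a fixed factor
(`IsSmoothInterpolation.exists_szlenkIterate_closedBall_subset`). After finitely many rounds the
diameter is at most `ε`, so the `ε`-index of `G` is at most `σ * k + 1 < ω ^ (γ + 1)`.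
-/

/-! ### Transfinite iterates of the Szlenk derivation -/

section Iterates

variable {𝕜 : Type v} [RCLike 𝕜] {E : Type u} [NormedAddCommGroup E] [NormedSpace 𝕜 E]

theorem szlenkDerivation_subset (ε : ℝ) (K : Set (StrongDual 𝕜 E)) :
    szlenkDerivation ε K ⊆ K := fun _ hx => hx.1

@[simp]
theorem szlenkIterate_zero (ε : ℝ) (K : Set (StrongDual 𝕜 E)) : szlenkIterate ε K 0 = K := by
  simp [szlenkIterate]

@[simp]
theorem szlenkIterate_add_one (ε : ℝ) (K : Set (StrongDual 𝕜 E)) (β : Ordinal.{u}) :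
    szlenkIterate ε K (β + 1) = szlenkDerivation ε (szlenkIterate ε K β) := by
  simp [szlenkIterate]

theorem szlenkIterate_limit (ε : ℝ) (K : Set (StrongDual 𝕜 E)) {β : Ordinal.{u}}
    (hβ : Order.IsSuccLimit β) :
    szlenkIterate ε K β = ⋂ (δ : Ordinal.{u}) (_ : δ < β), szlenkIterate ε K δ := by
  simp [szlenkIterate, Ordinal.limitRecOn_limit _ _ _ _ hβ]

theorem szlenkIterate_antitone (ε : ℝ) (K : Set (StrongDual 𝕜 E)) :
    Antitone (szlenkIterate ε K) := by
  intro γ β h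
  induction β using Ordinal.limitRecOn with
  | zero => rw [nonpos_iff_eq_zero.1 h]
  | add_one β ih =>
    rcases h.eq_or_lt with rfl | h
    · rfl
    · rw [szlenkIterate_add_one]
      exact (szlenkDerivation_subset _ _).trans (ih (Order.lt_add_one_iff.1 h))
  | limit β hβ _ =>
    rcases h.eq_or_lt with rfl | h
    · rfl
    · rw [szlenkIterate_limit ε K hβ]
      exact Set.iInter₂_subset γ h

theorem szlenkIterate_add (ε : ℝ) (K : Set (StrongDual 𝕜 E)) (β γ : Ordinal.{u}) :
    szlenkIterate ε K (β + γ) = szlenkIterate ε (szlenkIterate ε K β) γ := by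
  induction γ using Ordinal.limitRecOn with
  | zero => simp
  | add_one γ ih => rw [← add_assoc, szlenkIterate_add_one, szlenkIterate_add_one, ih]
  | limit γ hγ ih =>
    rw [szlenkIterate_limit _ _ (Ordinal.isSuccLimit_add β hγ), szlenkIterate_limit _ _ hγ]
    apply Set.Subset.antisymm
    · refine Set.subset_iInter₂ fun δ hδ => ?_
      rw [← ih δ hδ]
      exact Set.iInter₂_subset (β + δ) (by gcongr)
    · refine Set.subset_iInter₂ fun δ hδ => ?_
      obtain ⟨η, hη, hδη⟩ := (Ordinal.lt_add_iff_of_isSuccLimit hγ).1 hδ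
      refine (Set.iInter₂_subset η hη).trans ?_
      rw [← ih η hη]
      exact szlenkIterate_antitone ε K hδη.le

/-- The Szlenk derivation is local for the weak* topology. -/
theorem szlenkIterate_inter_subset (ε : ℝ) {K L : Set (StrongDual 𝕜 E)} {V : Set (WeakDual 𝕜 E)}
    (hV : IsOpen V) (h : K ∩ StrongDual.toWeakDual ⁻¹' V ⊆ L) (β : Ordinal.{u}) :
    szlenkIterate ε K β ∩ StrongDual.toWeakDual ⁻¹' V ⊆ szlenkIterate ε L β := by
  induction β using Ordinal.limitRecOn with
  | zero => simpa using h
  | add_one β ih =>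
    simp only [szlenkIterate_add_one]
    rintro x ⟨⟨hx, hxd⟩, hxV⟩
    refine ⟨ih ⟨hx, hxV⟩, fun U hU hxU => ?_⟩
    refine (hxd (V ∩ U) (hV.inter hU) ⟨hxV, hxU⟩).trans_le (Metric.ediam_mono ?_)
    rintro y ⟨hy, hyV, hyU⟩
    exact ⟨ih ⟨hy, hyV⟩, hyU⟩
  | limit β hβ ih =>
    rw [szlenkIterate_limit _ _ hβ, szlenkIterate_limit _ _ hβ]
    rintro x ⟨hx, hxV⟩
    simp only [Set.mem_iInter] at hx ⊢
    exact fun δ hδ => ih δ hδ ⟨hx δ hδ, hxV⟩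

theorem szlenkIterate_mono (ε : ℝ) {K L : Set (StrongDual 𝕜 E)} (h : K ⊆ L) (β : Ordinal.{u}) :
    szlenkIterate ε K β ⊆ szlenkIterate ε L β := by
  simpa using szlenkIterate_inter_subset ε (V := Set.univ) isOpen_univ (by simpa using h) β

theorem szlenkIterate_anti_eps {ε ε' : ℝ} (h : ε' ≤ ε) (K : Set (StrongDual 𝕜 E))
    (β : Ordinal.{u}) : szlenkIterate ε K β ⊆ szlenkIterate ε' K β := by
  induction β using Ordinal.limitRecOn with
  | zero => simp
  | add_one β ih =>
    simp only [szlenkIterate_add_one]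
    rintro x ⟨hx, hxd⟩
    exact ⟨ih hx, fun V hV hxV => (ENNReal.ofReal_le_ofReal h).trans_lt
      ((hxd V hV hxV).trans_le (Metric.ediam_mono (Set.inter_subset_inter_left _ ih)))⟩
  | limit β hβ ih =>
    rw [szlenkIterate_limit _ _ hβ, szlenkIterate_limit _ _ hβ]
    exact Set.iInter₂_mono ih

theorem szlenkDerivation_eq_empty {ε : ℝ} {K : Set (StrongDual 𝕜 E)}
    (h : Metric.ediam K ≤ ENNReal.ofReal ε) : szlenkDerivation ε K = ∅ := by
  refine Set.eq_empty_of_forall_notMem fun x hx => ?_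
  exact absurd (hx.2 Set.univ isOpen_univ trivial) (by simpa using h)

theorem isClosed_szlenkDerivation (ε : ℝ) {K : Set (StrongDual 𝕜 E)}
    (hK : IsClosed (StrongDual.toWeakDual '' K)) :
    IsClosed (StrongDual.toWeakDual '' szlenkDerivation ε K) := by
  rw [LinearEquiv.image_eq_preimage_symm] at hK ⊢
  have : StrongDual.toWeakDual.symm ⁻¹' szlenkDerivation ε K =
      StrongDual.toWeakDual.symm ⁻¹' K ∩ ⋂ (V : Set (WeakDual 𝕜 E)) (_ : IsOpen V)
        (_ : ¬ ENNReal.ofReal ε < Metric.ediam (K ∩ StrongDual.toWeakDual ⁻¹' V)), Vᶜ := by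
    ext x
    simp only [szlenkDerivation, Set.mem_preimage, Set.mem_ofPred_eq, Set.mem_inter_iff,
      Set.mem_iInter, Set.mem_compl_iff, LinearEquiv.apply_symm_apply]
    refine and_congr_right fun _ => forall₂_congr fun V _ => ?_
    tauto
  rw [this]
  exact hK.inter (isClosed_iInter fun V => isClosed_iInter fun hV => isClosed_iInter fun _ =>
    hV.isClosed_compl)

theorem isClosed_szlenkIterate (ε : ℝ) {K : Set (StrongDual 𝕜 E)}
    (hK : IsClosed (StrongDual.toWeakDual '' K)) (β : Ordinal.{u}) :
    IsClosed (StrongDual.toWeakDual '' szlenkIterate ε K β) := by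
  induction β using Ordinal.limitRecOn with
  | zero => simpa using hK
  | add_one β ih =>
    rw [szlenkIterate_add_one]
    exact isClosed_szlenkDerivation ε ih
  | limit β hβ ih =>
    rw [szlenkIterate_limit _ _ hβ]
    simp only [LinearEquiv.image_eq_preimage_symm, Set.preimage_iInter] at ih ⊢
    exact isClosed_iInter fun δ => isClosed_iInter fun hδ => ih δ hδ

/-- Weak* compactness makes the first empty iterate occur below any limit ordinal at which the
iterate is empty. -/
theorem exists_szlenkIterate_eq_empty (ε : ℝ) {K : Set (StrongDual 𝕜 E)}
    (hK : IsCompact (StrongDual.toWeakDual '' K)) {β : Ordinal.{u}} (hβ : Order.IsSuccLimit β)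
    (h : szlenkIterate ε K β = ∅) : ∃ γ < β, szlenkIterate ε K γ = ∅ := by
  by_contra! hne
  have hpos : 0 < β := hβ.bot_lt
  have : Nonempty (Set.Iio β) := ⟨⟨0, hpos⟩⟩
  have hcl : ∀ δ, IsClosed (StrongDual.toWeakDual '' szlenkIterate ε K δ) :=
    isClosed_szlenkIterate ε hK.isClosed
  obtain ⟨x, hx⟩ := IsCompact.nonempty_iInter_of_directed_nonempty_isCompact_isClosed
    (fun δ : Set.Iio β => StrongDual.toWeakDual '' szlenkIterate ε K δ)
    (Antitone.directed_ge fun γ δ hγδ => Set.image_mono (szlenkIterate_antitone ε K hγδ))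
    (fun δ => (hne δ δ.2).image _)
    (fun δ => hK.of_isClosed_subset (hcl δ) (Set.image_mono <| by
      simpa using szlenkIterate_antitone ε K (zero_le (a := (δ : Ordinal.{u})))))
    (fun δ => hcl δ)
  have : StrongDual.toWeakDual.symm x ∈ szlenkIterate ε K β := by
    rw [szlenkIterate_limit _ _ hβ]
    simp only [Set.mem_iInter] at hx ⊢
    intro δ hδ
    have := hx ⟨δ, hδ⟩
    rwa [LinearEquiv.image_eq_preimage_symm] at this
  simp [h] at this

end Iterates

/-! ### Comparing the iterates of two weak* continuous images -/

/-- Let `p` and `q` be weak* continuous maps from a compact space into dual spaces such that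
`δ`-closeness of the `q`-values forces `ε / 2`-closeness of the `p`-values. Then each iterate of
the `ε`-derivation of the range of `p` lifts into the corresponding iterate of the `δ`-derivation
of the range of `q`. -/
theorem szlenkIterate_range_subset {𝕜 : Type v} [RCLike 𝕜] {E F : Type u}
    [NormedAddCommGroup E] [NormedSpace 𝕜 E] [NormedAddCommGroup F] [NormedSpace 𝕜 F]
    {X : Type*} [TopologicalSpace X] [CompactSpace X]
    {p : X → StrongDual 𝕜 E} {q : X → StrongDual 𝕜 F}
    (hp : Continuous fun x => StrongDual.toWeakDual (p x))
    (hq : Continuous fun x => StrongDual.toWeakDual (q x))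
    {ε δ : ℝ} (hε : 0 ≤ ε) (hδ : 0 ≤ δ)
    (h : ∀ x y, ‖q x - q y‖ ≤ δ → ‖p x - p y‖ ≤ ε / 2) (β : Ordinal.{u}) :
    szlenkIterate ε (Set.range p) β ⊆ p '' (q ⁻¹' szlenkIterate δ (Set.range q) β) := by
  have hqc : ∀ β : Ordinal.{u}, IsClosed (q ⁻¹' szlenkIterate δ (Set.range q) β) := by
    intro β
    have hR : IsClosed (StrongDual.toWeakDual '' Set.range q) := by
      rw [← Set.range_comp]
      exact (isCompact_range hq).isClosed
    convert (isClosed_szlenkIterate δ hR β).preimage hq using 1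
    ext x
    simp
  have hfib : ∀ y, IsClosed (p ⁻¹' {y}) := by
    intro y
    convert (isClosed_singleton (x := StrongDual.toWeakDual y)).preimage hp using 1
    ext x
    simp
  induction β using Ordinal.limitRecOn with
  | zero => simp [Set.image_univ]
  | add_one β ih =>
    simp only [szlenkIterate_add_one]
    rintro y ⟨hyS, hyd⟩
    by_contra hcon
    -- Every point over `y` has a neighbourhood, saturated for `q`, of small `q`-diameter.
    have hU : ∀ x, p x = y → q x ∈ szlenkIterate δ (Set.range q) β →
        ∃ V : Set (WeakDual 𝕜 F), IsOpen V ∧ StrongDual.toWeakDual (q x) ∈ V ∧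
          Metric.ediam (szlenkIterate δ (Set.range q) β ∩ StrongDual.toWeakDual ⁻¹' V) ≤
            ENNReal.ofReal δ := by
      intro x hx hqx
      by_contra! hV
      exact hcon ⟨x, ⟨hqx, hV⟩, hx⟩
    set L := q ⁻¹' szlenkIterate δ (Set.range q) β with hL
    choose! V hVo hVm hVd using hU
    set U : Set X := ⋃ (x) (_ : p x = y) (_ : x ∈ L),
      (fun x => StrongDual.toWeakDual (q x)) ⁻¹' V x with hUdef
    have hUo : IsOpen U := isOpen_iUnion fun x => isOpen_iUnion fun hx => isOpen_iUnion fun hxL =>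
      (hVo x hx hxL).preimage hq
    -- The rest of `L` stays away from the fibre, so its image misses a neighbourhood of `y`.
    have hC : IsClosed ((fun x => StrongDual.toWeakDual (p x)) '' (L ∩ Uᶜ)) :=
      (((hqc β).inter hUo.isClosed_compl).isCompact.image hp).isClosed
    have hyC : StrongDual.toWeakDual y ∈ ((fun x => StrongDual.toWeakDual (p x)) '' (L ∩ Uᶜ))ᶜ := by
      rintro ⟨x, ⟨hxL, hxU⟩, hxy⟩
      have hxy : p x = y := StrongDual.toWeakDual.injective hxy
      exact hxU (Set.mem_iUnion.2 ⟨x, Set.mem_iUnion.2 ⟨hxy, Set.mem_iUnion.2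
        ⟨hxL, hVm x hxy hxL⟩⟩⟩)
    refine absurd (hyd _ hC.isOpen_compl hyC) (not_lt.2 ?_)
    -- Within `ε / 2` of `y`, hence of diameter at most `ε`.
    have key : ∀ z ∈ szlenkIterate ε (Set.range p) β ∩ StrongDual.toWeakDual ⁻¹'
        ((fun x => StrongDual.toWeakDual (p x)) '' (L ∩ Uᶜ))ᶜ, ‖z - y‖ ≤ ε / 2 := by
      rintro z ⟨hz, hzC⟩
      obtain ⟨x', hx'L, rfl⟩ := ih hz
      have hx'U : x' ∈ U := by
        by_contra hx'U
        exact hzC ⟨x', ⟨hx'L, hx'U⟩, rfl⟩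
      simp only [hUdef, Set.mem_iUnion] at hx'U
      obtain ⟨x, rfl, hxL, hx'⟩ := hx'U
      apply h
      have hmem : ∀ w ∈ L, StrongDual.toWeakDual (q w) ∈ V x → q w ∈
          szlenkIterate δ (Set.range q) β ∩ StrongDual.toWeakDual ⁻¹' V x :=
        fun w hw hwV => ⟨hw, hwV⟩
      have := (Metric.edist_le_ediam_of_mem (hmem x' hx'L hx')
        (hmem x hxL (hVm x rfl hxL))).trans (hVd x rfl hxL)
      rwa [edist_dist, ENNReal.ofReal_le_ofReal_iff hδ, dist_eq_norm] at this
    refine Metric.ediam_le fun a ha b hb => ?_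
    rw [edist_dist, ENNReal.ofReal_le_ofReal_iff hε]
    have h1 := key a ha
    have h2 := key b hb
    rw [← dist_eq_norm] at h1 h2
    linarith [dist_triangle_right a b y]
  | limit β hβ ih =>
    intro y hy
    rw [szlenkIterate_limit _ _ hβ] at hy
    simp only [Set.mem_iInter] at hy
    have : Nonempty (Set.Iio β) := ⟨⟨0, hβ.bot_lt⟩⟩
    have hcl := fun δ' : Set.Iio β => (hqc δ').inter (hfib y)
    obtain ⟨x, hx⟩ := IsCompact.nonempty_iInter_of_directed_nonempty_isCompact_isClosed
      (fun δ' : Set.Iio β => q ⁻¹' szlenkIterate δ (Set.range q) δ' ∩ p ⁻¹' {y})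
      (Antitone.directed_ge fun γ δ' hγδ => Set.inter_subset_inter_left _
        (Set.preimage_mono (szlenkIterate_antitone δ _ hγδ)))
      (fun δ' => by
        obtain ⟨x, hx, hxy⟩ := ih δ' δ'.2 (hy δ' δ'.2)
        exact ⟨x, hx, hxy⟩)
      (fun δ' => (hcl δ').isCompact) hcl
    simp only [Set.mem_iInter] at hx
    refine ⟨x, ?_, (hx ⟨0, hβ.bot_lt⟩).2⟩
    rw [Set.mem_preimage, szlenkIterate_limit _ _ hβ]
    simp only [Set.mem_iInter]
    exact fun δ' hδ' => (hx ⟨δ', hδ'⟩).1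

/-! ### The interpolation space of an operator -/

section Interpolation

variable {𝕜 : Type v} [RCLike 𝕜] {E F : Type u} [NormedAddCommGroup E] [NormedSpace 𝕜 E]
  [NormedAddCommGroup F] [NormedSpace 𝕜 F]

/-- The map `(e, y) ↦ 2ⁿ T e + 2⁻ⁿ y` from `E × F` onto `F`; it sends the unit ball of `E × F`
onto the set `2ⁿ T(B_E) + 2⁻ⁿ B_F`. -/
noncomputable def stepMap (T : E →L[𝕜] F) (n : ℕ) : E × F →L[𝕜] F :=
  (2 : 𝕜) ^ n • T.comp (ContinuousLinearMap.fst 𝕜 E F) +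
    ((2 : 𝕜) ^ n)⁻¹ • ContinuousLinearMap.snd 𝕜 E F

theorem stepMap_apply (T : E →L[𝕜] F) (n : ℕ) (z : E × F) :
    stepMap T n z = (2 : 𝕜) ^ n • T z.1 + ((2 : 𝕜) ^ n)⁻¹ • z.2 := rfl

instance isClosed_ker_stepMap (T : E →L[𝕜] F) (n : ℕ) :
    IsClosed (LinearMap.ker (stepMap T n).toLinearMap : Set (E × F)) :=
  (stepMap T n).isClosed_ker

/-- The space `F` renormed by the gauge of `2ⁿ T(B_E) + 2⁻ⁿ B_F`, encoded as the quotient of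
`E × F` by the kernel of `stepMap T n`. -/
def InterpolationStep (T : E →L[𝕜] F) (n : ℕ) : Type u :=
  (E × F) ⧸ LinearMap.ker (stepMap T n).toLinearMap

namespace InterpolationStep

variable (T : E →L[𝕜] F) (n : ℕ)

noncomputable instance : NormedAddCommGroup (InterpolationStep T n) :=
  inferInstanceAs (NormedAddCommGroup ((E × F) ⧸ LinearMap.ker (stepMap T n).toLinearMap))

noncomputable instance : NormedSpace 𝕜 (InterpolationStep T n) :=
  inferInstanceAs (NormedSpace 𝕜 ((E × F) ⧸ LinearMap.ker (stepMap T n).toLinearMap))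

instance [CompleteSpace E] [CompleteSpace F] : CompleteSpace (InterpolationStep T n) :=
  inferInstanceAs (CompleteSpace ((E × F) ⧸ LinearMap.ker (stepMap T n).toLinearMap))

/-- The quotient map `E × F → InterpolationStep T n`. -/
noncomputable def mk : E × F →ₗ[𝕜] InterpolationStep T n :=
  (LinearMap.ker (stepMap T n).toLinearMap).mkQ

/-- The identification of `InterpolationStep T n` with `F`. -/
noncomputable def val : InterpolationStep T n →L[𝕜] F :=
  LinearMap.mkContinuous
    ((LinearMap.ker (stepMap T n).toLinearMap).liftQ (stepMap T n).toLinearMap le_rfl)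
    ‖stepMap T n‖ <| fun x => by
      refine le_of_forall_pos_le_add fun ε hε => ?_
      have hη : 0 < ε / (‖stepMap T n‖ + 1) := by positivity
      obtain ⟨z, rfl, hz⟩ := Submodule.Quotient.norm_mk_lt
        (S := LinearMap.ker (stepMap T n).toLinearMap) x hη
      refine ((stepMap T n).le_opNorm z).trans ((mul_le_mul_of_nonneg_left hz.le
        (norm_nonneg _)).trans ?_)
      rw [mul_add]
      gcongr
      · rfl
      · rw [mul_div_assoc', div_le_iff₀ (by positivity)]
        nlinarith [norm_nonneg (stepMap T n)]

variable {T n}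

@[simp]
theorem val_mk (z : E × F) : val T n (mk T n z) = stepMap T n z := rfl

theorem norm_mk_le (z : E × F) : ‖mk T n z‖ ≤ ‖z‖ := Submodule.Quotient.norm_mk_le _ z

theorem mk_eq_mk {z w : E × F} (h : stepMap T n z = stepMap T n w) : mk T n z = mk T n w := by
  refine (Submodule.Quotient.eq _).2 ?_
  simp [h]

theorem exists_mk_eq (x : InterpolationStep T n) {ε : ℝ} (hε : 0 < ε) :
    ∃ z, mk T n z = x ∧ ‖z‖ < ‖x‖ + ε := by
  obtain ⟨z, hz, hz'⟩ := Submodule.Quotient.norm_mk_lt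
    (S := LinearMap.ker (stepMap T n).toLinearMap) x hε
  exact ⟨z, hz, hz'⟩

theorem norm_le (x : InterpolationStep T n) : ‖x‖ ≤ 2 ^ n * ‖val T n x‖ := by
  obtain ⟨z, rfl, -⟩ := exists_mk_eq x one_pos
  -- Every class has a representative in `0 × F`.
  have : mk T n z = mk T n (0, (2 : 𝕜) ^ n • stepMap T n z) := by
    apply mk_eq_mk
    rw [stepMap_apply T n (0, _)]
    simp
  rw [val_mk]
  conv_lhs => rw [this]
  refine (norm_mk_le _).trans ?_
  simp [Prod.norm_def, norm_smul]

/-- The dual norm of `f` with respect to the gauge of `2ⁿ T(B_E) + 2⁻ⁿ B_F` is at most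
`2ⁿ ‖T* f‖ + 2⁻ⁿ ‖f‖`. -/
theorem norm_apply_val_le (f : StrongDual 𝕜 F) (x : InterpolationStep T n) :
    ‖f (val T n x)‖ ≤ (2 ^ n * ‖f.comp T‖ + (2 ^ n)⁻¹ * ‖f‖) * ‖x‖ := by
  set C := 2 ^ n * ‖f.comp T‖ + (2 ^ n)⁻¹ * ‖f‖
  have hC : 0 ≤ C := by positivity
  refine le_of_forall_pos_le_add fun ε hε => ?_
  obtain ⟨z, rfl, hz⟩ := exists_mk_eq x (show 0 < ε / (C + 1) by positivity)
  have h1 : ‖f (T z.1)‖ ≤ ‖f.comp T‖ * ‖z‖ :=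
    ((f.comp T).le_opNorm z.1).trans (by gcongr; exact norm_fst_le z)
  have h2 : ‖f z.2‖ ≤ ‖f‖ * ‖z‖ := (f.le_opNorm z.2).trans (by gcongr; exact norm_snd_le z)
  calc ‖f (val T n (mk T n z))‖
      ≤ 2 ^ n * ‖f (T z.1)‖ + (2 ^ n)⁻¹ * ‖f z.2‖ := by
        rw [val_mk, stepMap_apply, map_add, map_smul, map_smul]
        exact (norm_add_le _ _).trans (by simp)
    _ ≤ 2 ^ n * (‖f.comp T‖ * ‖z‖) + (2 ^ n)⁻¹ * (‖f‖ * ‖z‖) := by gcongr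
    _ = C * ‖z‖ := by ring
    _ ≤ C * (‖mk T n z‖ + ε / (C + 1)) := by gcongr
    _ ≤ C * ‖mk T n z‖ + ε := by
        rw [mul_add]
        gcongr
        rw [mul_div_assoc', div_le_iff₀ (by positivity)]
        nlinarith

end InterpolationStep

open InterpolationStep

/-- The Davis–Figiel–Johnson–Pełczyński interpolation space of `T : E → F`: the `y ∈ F` whose
gauges `‖y‖ₙ` with respect to `2ⁿ T(B_E) + 2⁻ⁿ B_F` are square summable, with the `ℓ²` norm of
`(‖y‖ₙ)ₙ`. It is encoded as the diagonal of the `ℓ²` sum of the spaces `InterpolationStep T n`. -/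
noncomputable def interpolationSpace (T : E →L[𝕜] F) :
    Submodule 𝕜 (lp (fun n => InterpolationStep T n) 2) where
  carrier := {x | ∀ n, val T n (x n) = val T 0 (x 0)}
  add_mem' := by
    intro x y hx hy n
    simp [hx n, hy n]
  zero_mem' := by
    intro n
    simp
  smul_mem' := by
    intro c x hx n
    simp [hx n]

theorem norm_coord_le (T : E →L[𝕜] F) (n : ℕ) (x : lp (fun n => InterpolationStep T n) 2) :
    ‖x n‖ ≤ ‖x‖ := lp.norm_apply_le_norm (by simp) x n

/-- The `n`-th coordinate of the `ℓ²` sum. -/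
noncomputable def coord (T : E →L[𝕜] F) (n : ℕ) :
    lp (fun n => InterpolationStep T n) 2 →L[𝕜] InterpolationStep T n :=
  LinearMap.mkContinuous
    { toFun := fun x => x n
      map_add' := fun _ _ => rfl
      map_smul' := fun _ _ => rfl } 1 (fun x => by
      rw [one_mul]
      exact norm_coord_le T n x)

theorem isClosed_interpolationSpace (T : E →L[𝕜] F) :
    IsClosed (interpolationSpace T : Set (lp (fun n => InterpolationStep T n) 2)) := by
  have : (interpolationSpace T : Set (lp (fun n => InterpolationStep T n) 2)) =
      ⋂ n, {x | val T n (coord T n x) = val T 0 (coord T 0 x)} := by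
    ext x
    simp only [Set.mem_iInter]
    rfl
  rw [this]
  exact isClosed_iInter fun n => isClosed_eq (by fun_prop) (by fun_prop)

instance [CompleteSpace E] [CompleteSpace F] (T : E →L[𝕜] F) :
    CompleteSpace (interpolationSpace T) :=
  (isClosed_interpolationSpace T).completeSpace_coe

namespace interpolationSpace

/-- The inclusion of the interpolation space of `T : E → F` into `F`. -/
noncomputable def incl (T : E →L[𝕜] F) : interpolationSpace T →L[𝕜] F :=
  (val T 0 ∘L coord T 0) ∘L (interpolationSpace T).subtypeL

theorem val_coord (T : E →L[𝕜] F) (n : ℕ) (x : interpolationSpace T) :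
    val T n (x.1 n) = incl T x := x.2 n

theorem sum_sq_mk_le (T : E →L[𝕜] F) (e : E) (s : Finset ℕ) :
    ∑ n ∈ s, ‖mk T n (((2 : 𝕜) ^ n)⁻¹ • e, 0)‖ ^ (2 : ℝ) ≤ (2 * ‖e‖) ^ (2 : ℝ) := by
  simp only [Real.rpow_two]
  have h : ∀ n, ‖mk T n (((2 : 𝕜) ^ n)⁻¹ • e, 0)‖ ^ 2 ≤ (1 / 4 : ℝ) ^ n * ‖e‖ ^ 2 := by
    intro n
    have h1 : ‖mk T n (((2 : 𝕜) ^ n)⁻¹ • e, 0)‖ ≤ (1 / 2 : ℝ) ^ n * ‖e‖ := by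
      refine (norm_mk_le _).trans ?_
      simp [Prod.norm_def, norm_smul]
    calc _ ≤ ((1 / 2 : ℝ) ^ n * ‖e‖) ^ 2 := by gcongr
      _ = _ := by rw [mul_pow, ← pow_mul, mul_comm n, pow_mul]; norm_num
  calc _ ≤ ∑ n ∈ s, (1 / 4 : ℝ) ^ n * ‖e‖ ^ 2 := Finset.sum_le_sum fun n _ => h n
    _ = (∑ n ∈ s, (1 / 4 : ℝ) ^ n) * ‖e‖ ^ 2 := (Finset.sum_mul ..).symm
    _ ≤ (1 - 1 / 4)⁻¹ * ‖e‖ ^ 2 := by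
      gcongr
      rw [← tsum_geometric_of_lt_one (by norm_num) (by norm_num)]
      exact (summable_geometric_of_lt_one (by norm_num) (by norm_num)).sum_le_tsum s
        fun n _ => by positivity
    _ ≤ (2 * ‖e‖) ^ 2 := by rw [mul_pow]; gcongr; norm_num

/-- The operator `T : E → F` as an operator into its interpolation space: the `n`-th coordinate of
the image of `e` is the class of `(2⁻ⁿ e, 0)`. -/
noncomputable def lift (T : E →L[𝕜] F) : E →L[𝕜] interpolationSpace T :=
  LinearMap.mkContinuous
    { toFun := fun e => ⟨⟨fun n => mk T n (((2 : 𝕜) ^ n)⁻¹ • e, 0),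
          memℓp_gen' (C := (2 * ‖e‖) ^ (2 : ℝ)) fun s => by simpa using sum_sq_mk_le T e s⟩,
        fun n => by simp [stepMap_apply]⟩
      map_add' := fun e e' => by
        ext n
        change mk T n _ = mk T n _ + mk T n _
        rw [← map_add]
        simp
      map_smul' := fun c e => by
        ext n
        change mk T n _ = c • mk T n _
        rw [← map_smul, smul_comm]
        simp }
    2 (fun e => lp.norm_le_of_forall_sum_le (by simp) (by positivity)
      (by simpa using sum_sq_mk_le T e))

theorem incl_comp_lift (T : E →L[𝕜] F) : (incl T).comp (lift T) = T := by
  ext e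
  change val T 0 (mk T 0 _) = T e
  simp [stepMap_apply]

theorem norm_comp_incl_le (T : E →L[𝕜] F) (n : ℕ) (f : StrongDual 𝕜 F) :
    ‖f.comp (incl T)‖ ≤ 2 ^ n * ‖f.comp T‖ + (2 ^ n)⁻¹ * ‖f‖ := by
  refine ContinuousLinearMap.opNorm_le_bound _ (by positivity) fun x => ?_
  rw [ContinuousLinearMap.comp_apply, ← val_coord T n]
  refine (norm_apply_val_le f _).trans ?_
  gcongr
  exact norm_coord_le T n x.1

/-- Asymptotic uniform smoothness of the interpolation space relative to its inclusion `J`: far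
out in the `ℓ²` sum a fixed `g` is negligible, and the first coordinates of `x` are controlled by
`‖J x‖`. -/
theorem exists_norm_add_smul_sq_le (T : E →L[𝕜] F) (g : interpolationSpace T) (hg : ‖g‖ ≤ 1)
    {t : ℝ} (ht : 0 < t) : ∃ M : ℕ, ∀ x : interpolationSpace T, ‖x‖ ≤ 1 →
      ‖g + (t : 𝕜) • x‖ ^ 2 ≤ 1 + 2 * t * (M * ‖incl T x‖) + 3 * t ^ 2 := by
  have hp : 0 < (2 : ENNReal).toReal := by simp
  have hs : ∀ y : interpolationSpace T, HasSum (fun n => ‖y.1 n‖ ^ 2) (‖y‖ ^ 2) := by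
    intro y
    simpa using lp.hasSum_norm hp y.1
  have hle : ∀ (y : interpolationSpace T) (s : Finset ℕ), ∑ n ∈ s, ‖y.1 n‖ ^ 2 ≤ ‖y‖ ^ 2 :=
    fun y s => sum_le_hasSum s (fun _ _ => by positivity) (hs y)
  obtain ⟨N, hN⟩ : ∃ N : ℕ, ‖g‖ ^ 2 - t ^ 2 < ∑ n ∈ Finset.range N, ‖g.1 n‖ ^ 2 :=
    ((hs g).tendsto_sum_nat.eventually (lt_mem_nhds (by nlinarith))).exists
  refine ⟨∑ n ∈ Finset.range N, 2 ^ n, fun x hx => ?_⟩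
  refine le_of_tendsto_of_frequently (hs (g + (t : 𝕜) • x)).tendsto_sum_nat
    (Filter.Eventually.frequently ?_)
  filter_upwards [Filter.eventually_ge_atTop N] with m hm
  -- Square out each coordinate; beyond `N` use `2ab ≤ a² + b²` on the cross term.
  have hcoord : ∀ n, ‖(g + (t : 𝕜) • x).1 n‖ ≤ ‖g.1 n‖ + t * ‖x.1 n‖ := by
    intro n
    refine (norm_add_le (g.1 n) ((t : 𝕜) • x.1 n)).trans ?_
    rw [norm_smul, RCLike.norm_ofReal, abs_of_pos ht]
  have h1 : ∀ n, ‖(g + (t : 𝕜) • x).1 n‖ ^ 2 ≤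
      ‖g.1 n‖ ^ 2 + 2 * t * (2 ^ n * ‖incl T x‖) + t ^ 2 * ‖x.1 n‖ ^ 2 := by
    intro n
    have hgn : ‖g.1 n‖ ≤ 1 := (norm_coord_le T n g.1).trans hg
    have hxn : ‖x.1 n‖ ≤ 2 ^ n * ‖incl T x‖ := by
      rw [← val_coord T n]
      exact norm_le _
    have : ‖g.1 n‖ * ‖x.1 n‖ ≤ 1 * (2 ^ n * ‖incl T x‖) := by gcongr
    nlinarith [pow_le_pow_left₀ (norm_nonneg _) (hcoord n) 2]
  have h2 : ∀ n, ‖(g + (t : 𝕜) • x).1 n‖ ^ 2 ≤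
      2 * ‖g.1 n‖ ^ 2 + 2 * (t ^ 2 * ‖x.1 n‖ ^ 2) := by
    intro n
    nlinarith [pow_le_pow_left₀ (norm_nonneg _) (hcoord n) 2,
      sq_nonneg (‖g.1 n‖ - t * ‖x.1 n‖)]
  have hg1 : ‖g‖ ^ 2 ≤ 1 := pow_le_one₀ (norm_nonneg _) hg
  have hx1 : ‖x‖ ^ 2 ≤ 1 := pow_le_one₀ (norm_nonneg _) hx
  have hgm := hle g (Finset.range m)
  have hxm := hle x (Finset.range m)
  rw [← Finset.sum_range_add_sum_Ico _ hm] at hgm hxm ⊢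
  have e1 := Finset.sum_le_sum fun n (_ : n ∈ Finset.range N) => h1 n
  have e2 := Finset.sum_le_sum fun n (_ : n ∈ Finset.Ico N m) => h2 n
  simp only [Finset.sum_add_distrib, ← Finset.mul_sum, ← Finset.sum_mul] at e1 e2
  rw [Nat.cast_sum]
  simp only [Nat.cast_pow, Nat.cast_ofNat]
  have hx0 : 0 ≤ ∑ n ∈ Finset.range N, ‖x.1 n‖ ^ 2 := Finset.sum_nonneg fun _ _ => by positivity
  nlinarith [mul_le_mul_of_nonneg_left (hxm.trans hx1) (sq_nonneg t),
    mul_nonneg (sq_nonneg t) hx0]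

end interpolationSpace

end Interpolation

/-! ### Szlenk derivations in the dual of an interpolation space -/

/-- A functional dominated by `M‖J x‖ + r‖x‖` is the sum of a functional of norm at most `M`
pulled back along `J` and a functional of norm at most `r`. -/
theorem exists_eq_smul_comp_add_smul {𝕜 G F : Type*} [RCLike 𝕜] [NormedAddCommGroup G]
    [NormedSpace 𝕜 G] [NormedAddCommGroup F] [NormedSpace 𝕜 F] (J : G →L[𝕜] F)
    (h : StrongDual 𝕜 G) {M r : ℝ} (hM : 0 ≤ M) (hr : 0 < r)
    (hh : ∀ x, ‖h x‖ ≤ M * ‖J x‖ + r * ‖x‖) :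
    ∃ (f : StrongDual 𝕜 F) (k : StrongDual 𝕜 G), ‖f‖ ≤ 1 ∧ ‖k‖ ≤ 1 ∧
      h = (M : 𝕜) • f.comp J + (r : 𝕜) • k := by
  -- Extend `(M J x, r x) ↦ h x` from its subspace to the `ℓ¹` sum of `F` and `G`.
  let ι : G →ₗ[𝕜] WithLp 1 (F × G) :=
    (WithLp.linearEquiv 1 𝕜 (F × G)).symm.toLinearMap ∘ₗ
      ((M : 𝕜) • J.toLinearMap).prod ((r : 𝕜) • LinearMap.id)
  have hι : ∀ x, ι x = WithLp.toLp 1 ((M : 𝕜) • J x, (r : 𝕜) • x) := fun x => rfl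
  have hnorm : ∀ x, ‖ι x‖ = M * ‖J x‖ + r * ‖x‖ := by
    intro x
    rw [hι, WithLp.prod_norm_eq_of_L1]
    simp [norm_smul, abs_of_nonneg hM, abs_of_pos hr]
  have hinj : Function.Injective ι := by
    rw [injective_iff_map_eq_zero]
    intro x hx
    have := hnorm x
    rw [hx, norm_zero] at this
    have h2 : 0 ≤ M * ‖J x‖ := by positivity
    have h3 : 0 ≤ r * ‖x‖ := by positivity
    have h4 : r * ‖x‖ = 0 := by linarith
    simpa [hr.ne'] using h4
  let e := LinearEquiv.ofInjective ι hinj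
  let φ₀ : StrongDual 𝕜 (LinearMap.range ι) :=
    LinearMap.mkContinuous (h.toLinearMap ∘ₗ e.symm.toLinearMap) 1 (fun y => by
      obtain ⟨x, rfl⟩ := e.surjective y
      simp only [LinearMap.comp_apply, LinearEquiv.coe_coe, LinearEquiv.symm_apply_apply, one_mul]
      exact (hh x).trans (hnorm x).ge)
  have hφ₀ : ‖φ₀‖ ≤ 1 := LinearMap.mkContinuous_norm_le _ zero_le_one _
  obtain ⟨φ, hφ, hφn⟩ := exists_extension_norm_eq (LinearMap.range ι) φ₀
  have hφ1 : ∀ z, ‖φ z‖ ≤ 1 * ‖z‖ := fun z => φ.le_of_opNorm_le (hφn.trans_le hφ₀) z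
  have hφι : ∀ x, φ (ι x) = h x := by
    intro x
    have h1 : φ (ι x) = φ₀ (e x) := hφ (e x)
    rw [h1]
    change h (e.symm (e x)) = h x
    rw [LinearEquiv.symm_apply_apply]
  let i₁ : F →ₗ[𝕜] WithLp 1 (F × G) :=
    (WithLp.linearEquiv 1 𝕜 (F × G)).symm.toLinearMap ∘ₗ LinearMap.inl 𝕜 F G
  let i₂ : G →ₗ[𝕜] WithLp 1 (F × G) :=
    (WithLp.linearEquiv 1 𝕜 (F × G)).symm.toLinearMap ∘ₗ LinearMap.inr 𝕜 F G
  have hi₁ : ∀ y, ‖i₁ y‖ = ‖y‖ := by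
    intro y
    rw [WithLp.prod_norm_eq_of_L1]
    simp [i₁]
  have hi₂ : ∀ y, ‖i₂ y‖ = ‖y‖ := by
    intro y
    rw [WithLp.prod_norm_eq_of_L1]
    simp [i₂]
  refine ⟨(φ.toLinearMap ∘ₗ i₁).mkContinuous 1 fun y => hi₁ y ▸ hφ1 (i₁ y),
    (φ.toLinearMap ∘ₗ i₂).mkContinuous 1 fun y => hi₂ y ▸ hφ1 (i₂ y),
    LinearMap.mkContinuous_norm_le _ zero_le_one _,
    LinearMap.mkContinuous_norm_le _ zero_le_one _, ?_⟩
  ext x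
  have hsum : ι x = (M : 𝕜) • i₁ (J x) + (r : 𝕜) • i₂ x := by
    rw [hι]
    apply WithLp.ofLp_injective
    ext <;> simp [i₁, i₂]
  rw [← hφι, hsum, map_add, map_smul, map_smul]
  rfl

section

variable {𝕜 : Type v} [RCLike 𝕜] {E F G : Type u} [NormedAddCommGroup E] [NormedSpace 𝕜 E]
  [NormedAddCommGroup F] [NormedSpace 𝕜 F] [NormedAddCommGroup G] [NormedSpace 𝕜 G]

/-- The two features of the inclusion `J : G → F` of an interpolation space of `T : E → F` that
bound the Szlenk index of `G`: the unit ball of `G` is almost absorbed by multiples of `T(B_E)`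
(stated dually), and `G` is asymptotically uniformly smooth up to errors measured by `J`. -/
structure IsSmoothInterpolation (T : E →L[𝕜] F) (J : G →L[𝕜] F) : Prop where
  norm_comp_le (n : ℕ) (f : StrongDual 𝕜 F) :
    ‖f.comp J‖ ≤ 2 ^ n * ‖f.comp T‖ + (2 ^ n)⁻¹ * ‖f‖
  exists_norm_add_smul_sq_le (g : G) (hg : ‖g‖ ≤ 1) (t : ℝ) (ht : 0 < t) : ∃ M : ℕ,
    ∀ x : G, ‖x‖ ≤ 1 → ‖g + (t : 𝕜) • x‖ ^ 2 ≤ 1 + 2 * t * (M * ‖J x‖) + 3 * t ^ 2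

theorem isSmoothInterpolation_incl (T : E →L[𝕜] F) :
    IsSmoothInterpolation T (interpolationSpace.incl T) :=
  ⟨interpolationSpace.norm_comp_incl_le T,
    fun g hg _ ht => interpolationSpace.exists_norm_add_smul_sq_le T g hg ht⟩

variable {T : E →L[𝕜] F} {J : G →L[𝕜] F}

namespace IsSmoothInterpolation

/-- On a narrow slice of the dual ball, functionals on the interpolation space are nearly
controlled by the inclusion into `F`. -/
theorem exists_norm_apply_le_of_mem_slice (hJ : IsSmoothInterpolation T J) (g : G)
    (hg : ‖g‖ ≤ 1) {t : ℝ} (ht : 0 < t) : ∃ M : ℕ, ∀ h : StrongDual 𝕜 G,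
      ‖h‖ ≤ 1 → 1 - t ^ 2 / 2 < RCLike.re (h g) →
      ∀ x, ‖h x‖ ≤ M * ‖J x‖ + 2 * t * ‖x‖ := by
  obtain ⟨M, hM⟩ := hJ.exists_norm_add_smul_sq_le g hg t ht
  refine ⟨M, fun h hh hhg x => ?_⟩
  rcases eq_or_ne x 0 with rfl | hx
  · simp
  have hx0 : 0 < ‖x‖ := norm_pos_iff.2 hx
  obtain ⟨c, hc, hcx⟩ := RCLike.exists_norm_eq_mul_self (h x)
  -- Normalize `x` and rotate it so that `h` is nonnegative on it.
  set y := ((‖x‖⁻¹ : ℝ) : 𝕜) • c • x with hy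
  have hyn : ‖y‖ ≤ 1 := by
    rw [hy, norm_smul, norm_smul, hc, RCLike.norm_ofReal, abs_of_pos (by positivity),
      one_mul, inv_mul_cancel₀ hx0.ne']
  have hJy : ‖J y‖ = ‖x‖⁻¹ * ‖J x‖ := by
    rw [hy, map_smul, map_smul, norm_smul, norm_smul, hc, RCLike.norm_ofReal,
      abs_of_pos (by positivity), one_mul]
  have hhy : RCLike.re (h y) = ‖x‖⁻¹ * ‖h x‖ := by
    rw [hy, h.map_smul, h.map_smul, smul_eq_mul, smul_eq_mul, ← hcx, ← RCLike.ofReal_mul,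
      RCLike.ofReal_re]
  have hbound : ‖g + (t : 𝕜) • y‖ ≤ 1 + t * (M * ‖J y‖) + 3 * t ^ 2 / 2 := by
    refine abs_le_of_sq_le_sq' ?_ (by positivity) |>.2
    refine (hM y hyn).trans ?_
    have : 0 ≤ t * (M * ‖J y‖) := by positivity
    nlinarith [sq_nonneg (t * (M * ‖J y‖) + 3 * t ^ 2 / 2)]
  have h1 : RCLike.re (h g) + t * RCLike.re (h y) ≤ ‖g + (t : 𝕜) • y‖ := by
    have : RCLike.re (h (g + (t : 𝕜) • y)) = RCLike.re (h g) + t * RCLike.re (h y) := by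
      rw [map_add, map_smul, smul_eq_mul, map_add, RCLike.re_ofReal_mul]
    rw [← this]
    refine (RCLike.re_le_norm _).trans ((h.le_of_opNorm_le hh _).trans (one_mul _).le)
  have h2 : RCLike.re (h y) ≤ M * ‖J y‖ + 2 * t := by
    refine le_of_mul_le_mul_left ?_ ht
    nlinarith
  rw [hhy, hJy] at h2
  calc ‖h x‖ = ‖x‖ * (‖x‖⁻¹ * ‖h x‖) := by field_simp
    _ ≤ ‖x‖ * (M * (‖x‖⁻¹ * ‖J x‖) + 2 * t) := by gcongr
    _ = M * ‖J x‖ + 2 * t * ‖x‖ := by field_simp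

/-- If all `δ`-derivations of `T* B_{F*}` are exhausted after `σ` steps, then so is the
`ε`-derivation of each subset of `M J* B_{F*} + r B_{G*}` with `r ≤ ε / 8`. The number of steps does
not depend on `M`. -/
theorem szlenkIterate_eq_empty (hJ : IsSmoothInterpolation T J) {σ : Ordinal.{u}}
    (hσ : ∀ δ : ℝ, 0 < δ → szlenkIterate δ
      ((fun f : StrongDual 𝕜 F => f.comp T) '' Metric.closedBall 0 1) σ = ∅)
    {ε : ℝ} (hε : 0 < ε) (M : ℕ) {r : ℝ} (hr : 0 ≤ r) (hrε : r ≤ ε / 8)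
    {L : Set (StrongDual 𝕜 G)}
    (hL : ∀ h ∈ L, ∃ (f : StrongDual 𝕜 F) (k : StrongDual 𝕜 G),
      ‖f‖ ≤ 1 ∧ ‖k‖ ≤ 1 ∧ h = ((M : ℝ) : 𝕜) • f.comp J + (r : 𝕜) • k) :
    szlenkIterate ε L σ = ∅ := by
  let B : Set (WeakDual 𝕜 F) := WeakDual.toStrongDual ⁻¹' Metric.closedBall 0 1
  let B' : Set (WeakDual 𝕜 G) :=
    WeakDual.toStrongDual ⁻¹' Metric.closedBall 0 1
  have : CompactSpace B := isCompact_iff_compactSpace.1 (WeakDual.isCompact_closedBall _ _)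
  have : CompactSpace B' := isCompact_iff_compactSpace.1 (WeakDual.isCompact_closedBall _ _)
  let p : B × B' → StrongDual 𝕜 G := fun z =>
    ((M : ℝ) : 𝕜) • (WeakDual.toStrongDual z.1.1).comp J +
      (r : 𝕜) • WeakDual.toStrongDual z.2.1
  let q : B × B' → StrongDual 𝕜 E := fun z => (WeakDual.toStrongDual z.1.1).comp T
  have hp : Continuous fun z => StrongDual.toWeakDual (p z) := by
    refine WeakDual.continuous_of_continuous_eval fun x => ?_
    exact (((WeakDual.eval_continuous (J x)).comp
      (continuous_subtype_val.comp continuous_fst)).const_smul ((M : ℝ) : 𝕜)).add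
      (((WeakDual.eval_continuous x).comp
        (continuous_subtype_val.comp continuous_snd)).const_smul (r : 𝕜))
  have hq : Continuous fun z => StrongDual.toWeakDual (q z) := by
    refine WeakDual.continuous_of_continuous_eval fun x => ?_
    exact (WeakDual.eval_continuous (T x)).comp (continuous_subtype_val.comp continuous_fst)
  obtain ⟨n, hn⟩ : ∃ n : ℕ, (M : ℝ) * 2 * (2 ^ n)⁻¹ ≤ ε / 8 := by
    obtain ⟨n, hn⟩ := pow_unbounded_of_one_lt ((M : ℝ) * 2 / (ε / 8)) one_lt_two
    refine ⟨n, ?_⟩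
    rw [div_lt_iff₀ (by positivity)] at hn
    rw [← div_eq_mul_inv, div_le_iff₀ (by positivity)]
    linarith
  set δ : ℝ := ε / 8 / ((M + 1) * 2 ^ n) with hδ
  have hδ0 : 0 < δ := by positivity
  have hMδ : (M : ℝ) * (2 ^ n * δ) ≤ ε / 8 := by
    rw [hδ, ← mul_assoc, mul_div_assoc', div_le_iff₀ (by positivity)]
    have : (0 : ℝ) ≤ ε / 8 * 2 ^ n := by positivity
    nlinarith
  have hclose : ∀ z w, ‖q z - q w‖ ≤ δ → ‖p z - p w‖ ≤ ε / 2 := by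
    rintro ⟨⟨f, hf⟩, ⟨k, hk⟩⟩ ⟨⟨f', hf'⟩, ⟨k', hk'⟩⟩ hqq
    have hf : ‖WeakDual.toStrongDual f‖ ≤ 1 := mem_closedBall_zero_iff.1 hf
    have hf' : ‖WeakDual.toStrongDual f'‖ ≤ 1 := mem_closedBall_zero_iff.1 hf'
    have hk : ‖WeakDual.toStrongDual k‖ ≤ 1 := mem_closedBall_zero_iff.1 hk
    have hk' : ‖WeakDual.toStrongDual k'‖ ≤ 1 := mem_closedBall_zero_iff.1 hk'
    set a := WeakDual.toStrongDual f - WeakDual.toStrongDual f' with ha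
    set b := WeakDual.toStrongDual k - WeakDual.toStrongDual k' with hb
    have ha2 : ‖a‖ ≤ 2 := (norm_sub_le _ _).trans ((add_le_add hf hf').trans one_add_one_eq_two.le)
    have hb2 : ‖b‖ ≤ 2 := (norm_sub_le _ _).trans ((add_le_add hk hk').trans one_add_one_eq_two.le)
    have hqa : ‖a.comp T‖ ≤ δ := by
      rw [ha, ContinuousLinearMap.sub_comp]
      exact hqq
    have hpa : p (⟨f, ‹_›⟩, ⟨k, ‹_›⟩) - p (⟨f', ‹_›⟩, ⟨k', ‹_›⟩) =
        ((M : ℝ) : 𝕜) • a.comp J + (r : 𝕜) • b := by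
      simp only [p, ha, hb, ContinuousLinearMap.sub_comp, smul_sub]
      abel
    rw [hpa]
    calc _ ≤ M * ‖a.comp J‖ + r * ‖b‖ := by
          refine (norm_add_le _ _).trans ?_
          rw [norm_smul, norm_smul, RCLike.norm_ofReal, RCLike.norm_ofReal, abs_of_nonneg hr,
            abs_of_nonneg (Nat.cast_nonneg M)]
      _ ≤ M * (2 ^ n * δ + (2 ^ n)⁻¹ * 2) + r * 2 := by
          gcongr
          refine (hJ.norm_comp_le n a).trans ?_
          gcongr
      _ ≤ ε / 2 := by linarith
  have hLp : L ⊆ Set.range p := by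
    intro h hh
    obtain ⟨f, k, hf, hk, rfl⟩ := hL h hh
    exact ⟨(⟨StrongDual.toWeakDual f, mem_closedBall_zero_iff.2 hf⟩,
      ⟨StrongDual.toWeakDual k, mem_closedBall_zero_iff.2 hk⟩), rfl⟩
  have hqT : Set.range q ⊆ (fun f : StrongDual 𝕜 F => f.comp T) '' Metric.closedBall 0 1 := by
    rintro _ ⟨z, rfl⟩
    exact ⟨_, z.1.2, rfl⟩
  have hq0 : szlenkIterate δ (Set.range q) σ = ∅ :=
    Set.subset_empty_iff.1 ((szlenkIterate_mono δ hqT σ).trans (hσ δ hδ0).le)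
  refine Set.subset_empty_iff.1 ((szlenkIterate_mono ε hLp σ).trans
    ((szlenkIterate_range_subset hp hq hε.le hδ0.le hclose σ).trans ?_))
  simp [hq0]

/-- If all `δ`-derivations of `T* B_{F*}` are exhausted after `σ` steps, then `σ` steps of the
`ε`-derivation shrink each ball of radius at most one in the dual of `G` by a common factor
`ρ < 1`. -/
theorem exists_szlenkIterate_closedBall_subset (hJ : IsSmoothInterpolation T J) {σ : Ordinal.{u}}
    (hσ : ∀ δ : ℝ, 0 < δ → szlenkIterate δ
      ((fun f : StrongDual 𝕜 F => f.comp T) '' Metric.closedBall 0 1) σ = ∅)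
    {ε : ℝ} (hε : 0 < ε) : ∃ ρ : ℝ, 0 ≤ ρ ∧ ρ < 1 ∧ ∀ a : ℝ, 0 ≤ a → a ≤ 1 →
      szlenkIterate ε (Metric.closedBall (0 : StrongDual 𝕜 G) a) σ ⊆
        Metric.closedBall 0 (a * ρ) := by
  -- The slices of depth `t² / 2` lie in `M J* B_{F*} + 2t B_{G*}`, and `2t ≤ ε / 8` is needed.
  set t := min 1 (ε / 16) with htdef
  have ht : 0 < t := lt_min one_pos (by positivity)
  have ht1 : t ≤ 1 := min_le_left _ _
  have htε : t ≤ ε / 16 := min_le_right _ _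
  have hρ : 0 ≤ 1 - t ^ 2 / 2 := by nlinarith
  refine ⟨1 - t ^ 2 / 2, hρ, by nlinarith, fun a ha0 ha1 z hz => ?_⟩
  rw [mem_closedBall_zero_iff]
  by_contra! hza
  obtain ⟨g₀, hg₀, hg₀z⟩ := ContinuousLinearMap.exists_lt_apply_of_lt_opNorm z hza
  obtain ⟨c, hc, hcz⟩ := RCLike.exists_norm_eq_mul_self (z g₀)
  set g := c • g₀ with hgdef
  have hg : ‖g‖ ≤ 1 := by
    rw [hgdef, norm_smul, hc, one_mul]
    exact hg₀.le
  have hzg : a * (1 - t ^ 2 / 2) < RCLike.re (z g) := by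
    rwa [hgdef, map_smul, smul_eq_mul, ← hcz, RCLike.ofReal_re]
  obtain ⟨M, hM⟩ := hJ.exists_norm_apply_le_of_mem_slice g hg ht
  let V : Set (WeakDual 𝕜 G) := {h | a * (1 - t ^ 2 / 2) < RCLike.re (h g)}
  have hV : IsOpen V :=
    isOpen_lt continuous_const (RCLike.continuous_re.comp (WeakDual.eval_continuous g))
  have hempty : szlenkIterate ε
      (Metric.closedBall (0 : StrongDual 𝕜 G) a ∩
        StrongDual.toWeakDual ⁻¹' V) σ = ∅ := by
    refine hJ.szlenkIterate_eq_empty hσ hε M (r := 2 * t) (by positivity)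
      (by linarith) ?_
    rintro h ⟨hha, hhV⟩
    have hha : ‖h‖ ≤ a := mem_closedBall_zero_iff.1 hha
    have hhV : a * (1 - t ^ 2 / 2) < RCLike.re (h g) := hhV
    have hapos : 0 < a := by
      refine ha0.lt_of_ne ?_
      rintro rfl
      have : h = 0 := by simpa using hha
      simp [this] at hhV
    -- Decompose `a⁻¹ h` and scale back; this needs no new constants since `a ≤ 1`.
    have hane : (a : 𝕜) ≠ 0 := by exact_mod_cast hapos.ne'
    have key := hM (((a⁻¹ : ℝ) : 𝕜) • h) (by
        rw [norm_smul, RCLike.norm_ofReal, abs_of_pos (by positivity), inv_mul_le_iff₀ hapos,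
          mul_one]
        exact hha) (by
        rw [smul_apply, smul_eq_mul, RCLike.re_ofReal_mul,
          lt_inv_mul_iff₀ hapos]
        exact hhV)
    obtain ⟨f, k, hf, hk, hfk⟩ := exists_eq_smul_comp_add_smul J _
      (Nat.cast_nonneg M) (by positivity : 0 < 2 * t) key
    have hsmul : ∀ {G : Type u} [NormedAddCommGroup G] [NormedSpace 𝕜 G] (f : StrongDual 𝕜 G),
        ‖f‖ ≤ 1 → ‖(a : 𝕜) • f‖ ≤ 1 := by
      intro G _ _ f hf
      rw [norm_smul, RCLike.norm_ofReal, abs_of_pos hapos]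
      exact mul_le_one₀ ha1 (norm_nonneg _) hf
    refine ⟨(a : 𝕜) • f, (a : 𝕜) • k, hsmul f hf, hsmul k hk, ?_⟩
    calc h = (a : 𝕜) • (((a⁻¹ : ℝ) : 𝕜) • h) := by
          rw [smul_smul, RCLike.ofReal_inv, mul_inv_cancel₀ hane, one_smul]
      _ = _ := by
          rw [hfk, smul_add, ContinuousLinearMap.smul_comp, smul_comm, smul_comm (a : 𝕜)]
  have := szlenkIterate_inter_subset ε hV subset_rfl σ ⟨hz, hzg⟩
  simp [hempty] at this

/-- If all `δ`-derivations of `T* B_{F*}` are exhausted after `σ` steps, then the `ε`-derivation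
of the dual ball of `G` is exhausted one step after a finite multiple of `σ`. -/
theorem exists_szlenkIterate_mul_add_one_eq_empty (hJ : IsSmoothInterpolation T J) {σ : Ordinal.{u}}
    (hσ : ∀ δ : ℝ, 0 < δ → szlenkIterate δ
      ((fun f : StrongDual 𝕜 F => f.comp T) '' Metric.closedBall 0 1) σ = ∅)
    {ε : ℝ} (hε : 0 < ε) : ∃ k : ℕ, szlenkIterate ε
      (Metric.closedBall (0 : StrongDual 𝕜 G) 1) (σ * k + 1) = ∅ := by
  obtain ⟨ρ, hρ0, hρ1, hρ⟩ := hJ.exists_szlenkIterate_closedBall_subset hσ hε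
  have hpow : ∀ k : ℕ, szlenkIterate ε
      (Metric.closedBall (0 : StrongDual 𝕜 G) 1) (σ * k) ⊆
        Metric.closedBall 0 (ρ ^ k) := by
    intro k
    induction k with
    | zero => simp
    | succ k ih =>
      rw [Nat.cast_succ, mul_add_one, szlenkIterate_add, pow_succ]
      exact (szlenkIterate_mono ε ih σ).trans
        (hρ (ρ ^ k) (by positivity) (pow_le_one₀ hρ0 hρ1.le))
  obtain ⟨k, hk⟩ := exists_pow_lt_of_lt_one (half_pos hε) hρ1
  refine ⟨k, ?_⟩
  rw [szlenkIterate_add_one]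
  refine szlenkDerivation_eq_empty (Metric.ediam_le fun x hx y hy => ?_)
  rw [edist_dist, ENNReal.ofReal_le_ofReal_iff hε.le]
  have h1 := Metric.mem_closedBall.1 (hpow k hx)
  have h2 := Metric.mem_closedBall.1 (hpow k hy)
  linarith [dist_triangle_right x y 0]

end IsSmoothInterpolation

end

/-! ### Szlenk indices and ordinals of uncountable cofinality -/

theorem szlenkIndex_le_coe_iff {𝕜 : Type v} [RCLike 𝕜] {E : Type u} [NormedAddCommGroup E]
    [NormedSpace 𝕜 E] {K : Set (StrongDual 𝕜 E)} {β : Ordinal.{u}} :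
    szlenkIndex K ≤ (β : WithTop Ordinal.{u}) ↔
      ∀ ε : ℝ, 0 < ε → szlenkIterate ε K β = ∅ := by
  simp only [szlenkIndex, epsSzlenkIndex, iSup_le_iff, WithTop.coe_le_coe, Order.add_one_le_iff]
  refine forall₂_congr fun ε _ => ⟨fun h => ?_, fun h γ hγ => ?_⟩
  · by_contra hne
    exact lt_irrefl _ (h β (Set.nonempty_iff_ne_empty.2 hne))
  · by_contra! hβγ
    exact (hγ.mono (szlenkIterate_antitone ε K hβγ)).ne_empty h

theorem isCompact_image_adjoint_closedBall {𝕜 : Type v} [RCLike 𝕜] {E F : Type u}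
    [NormedAddCommGroup E] [NormedSpace 𝕜 E] [NormedAddCommGroup F] [NormedSpace 𝕜 F]
    (T : E →L[𝕜] F) : IsCompact (StrongDual.toWeakDual ''
      ((fun f : StrongDual 𝕜 F => f.comp T) '' Metric.closedBall 0 1)) := by
  have hc : Continuous fun f : WeakDual 𝕜 F =>
      StrongDual.toWeakDual ((WeakDual.toStrongDual f).comp T) :=
    WeakDual.continuous_of_continuous_eval fun x => WeakDual.eval_continuous (T x)
  convert (WeakDual.isCompact_closedBall (0 : StrongDual 𝕜 F) 1).image hc using 1
  ext g
  constructor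
  · rintro ⟨_, ⟨f, hf, rfl⟩, rfl⟩
    exact ⟨StrongDual.toWeakDual f, hf, rfl⟩
  · rintro ⟨f, hf, rfl⟩
    exact ⟨_, ⟨WeakDual.toStrongDual f, hf, rfl⟩, rfl⟩

/-- For `α` of uncountable cofinality, a Szlenk index of at most `ω ^ α` is in fact at most
`ω ^ γ` for some `γ < α`: each of the countably many relevant `ε`-indices is less than `ω ^ α` by
weak* compactness. -/
theorem exists_lt_szlenkIndex_le_omega0_opow {𝕜 : Type v} [RCLike 𝕜] {E : Type u}
    [NormedAddCommGroup E] [NormedSpace 𝕜 E] {K : Set (StrongDual 𝕜 E)}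
    (hK : IsCompact (StrongDual.toWeakDual '' K)) {α : Ordinal.{u}} (hα : ℵ₀ < α.cof)
    (h : szlenkIndex K ≤ ((ω ^ α : Ordinal.{u}) : WithTop Ordinal.{u})) :
    ∃ γ < α, szlenkIndex K ≤ ((ω ^ γ : Ordinal.{u}) : WithTop Ordinal.{u}) := by
  have hlim : Order.IsSuccLimit α := Ordinal.one_lt_cof_iff.1 (Cardinal.one_lt_aleph0.trans hα)
  rw [szlenkIndex_le_coe_iff] at h
  have hn : ∀ n : ℕ, ∃ γ < α, szlenkIterate (1 / ((n : ℝ) + 1)) K (ω ^ γ) = ∅ := by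
    intro n
    obtain ⟨β, hβ, hβe⟩ := exists_szlenkIterate_eq_empty _ hK
      (Ordinal.isSuccLimit_opow Ordinal.one_lt_omega0 hlim) (h (1 / ((n : ℝ) + 1)) (by positivity))
    obtain ⟨γ, hγ, hβγ⟩ := (Ordinal.lt_opow_of_isSuccLimit Ordinal.omega0_ne_zero hlim).1 hβ
    exact ⟨γ, hγ, Set.subset_empty_iff.1 ((szlenkIterate_antitone _ K hβγ.le).trans hβe.le)⟩
  choose γ hγ hγe using hn
  refine ⟨⨆ n, γ n, Ordinal.lift_iSup_lt_of_lt_cof (by simpa using hα) hγ,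
    szlenkIndex_le_coe_iff.2 fun ε hε => ?_⟩
  obtain ⟨n, hn⟩ := exists_nat_one_div_lt hε
  have hle : ω ^ γ n ≤ ω ^ ⨆ n, γ n :=
    Ordinal.opow_le_opow_right Ordinal.omega0_pos (Ordinal.le_iSup γ n)
  exact Set.subset_empty_iff.1 ((szlenkIterate_anti_eps hn.le K _).trans
    ((szlenkIterate_antitone _ K hle).trans (hγe n).le))

/-- The interpolation space costs at most one in the exponent of the Szlenk index. -/
theorem spaceSzlenkIndex_interpolationSpace_le {𝕜 : Type v} [RCLike 𝕜] {E F : Type u}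
    [NormedAddCommGroup E] [NormedSpace 𝕜 E] [NormedAddCommGroup F] [NormedSpace 𝕜 F]
    (T : E →L[𝕜] F) {γ : Ordinal.{u}}
    (h : operatorSzlenkIndex T ≤ ((ω ^ γ : Ordinal.{u}) : WithTop Ordinal.{u})) :
    spaceSzlenkIndex 𝕜 (interpolationSpace T) ≤
      ((ω ^ (γ + 1) : Ordinal.{u}) : WithTop Ordinal.{u}) := by
  refine szlenkIndex_le_coe_iff.2 fun ε hε => ?_
  obtain ⟨k, hk⟩ := 
    (isSmoothInterpolation_incl T).exists_szlenkIterate_mul_add_one_eq_empty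
      (szlenkIndex_le_coe_iff.1 h) hε
  have hle : ω ^ γ * k + 1 ≤ ω ^ (γ + 1) :=
    Order.add_one_le_of_lt (Ordinal.opow_mul_lt_opow (Ordinal.natCast_lt_omega0 k)
      (Order.lt_add_one_iff.2 le_rfl))
  exact Set.subset_empty_iff.1 ((szlenkIterate_antitone ε _ hle).trans hk.le)

theorem operatorSzlenkIndex_id {𝕜 : Type v} [RCLike 𝕜] {E : Type u} [NormedAddCommGroup E]
    [NormedSpace 𝕜 E] :
    operatorSzlenkIndex (ContinuousLinearMap.id 𝕜 E) = spaceSzlenkIndex 𝕜 E := by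
  simp [operatorSzlenkIndex, spaceSzlenkIndex]

theorem corollary3p9 {𝕜 : Type v} [RCLike 𝕜] (α : Ordinal.{u}) (hα : ℵ₀ < α.cof) :
    (szlenkOperators 𝕜 α).HasFactorizationProperty ∧
    ∀ (E F : Type u) [NormedAddCommGroup E] [NormedSpace 𝕜 E] [CompleteSpace E]
      [NormedAddCommGroup F] [NormedSpace 𝕜 F] [CompleteSpace F] (T : E →L[𝕜] F),
      operatorSzlenkIndex T ≤ ((ω ^ α : Ordinal.{u}) : WithTop Ordinal.{u}) →
      ∃ (G : Type u) (_ : NormedAddCommGroup G) (_ : NormedSpace 𝕜 G) (_ : CompleteSpace G)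
        (A : E →L[𝕜] G) (B : G →L[𝕜] F),
        spaceSzlenkIndex 𝕜 G ≤ ((ω ^ α : Ordinal.{u}) : WithTop Ordinal.{u}) ∧
        T = B.comp A := by
  have hlim : Order.IsSuccLimit α := Ordinal.one_lt_cof_iff.1 (Cardinal.one_lt_aleph0.trans hα)
  have key : ∀ (E F : Type u) [NormedAddCommGroup E] [NormedSpace 𝕜 E] [CompleteSpace E]
      [NormedAddCommGroup F] [NormedSpace 𝕜 F] [CompleteSpace F] (T : E →L[𝕜] F),
      operatorSzlenkIndex T ≤ ((ω ^ α : Ordinal.{u}) : WithTop Ordinal.{u}) →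
      ∃ (G : Type u) (_ : NormedAddCommGroup G) (_ : NormedSpace 𝕜 G) (_ : CompleteSpace G)
        (A : E →L[𝕜] G) (B : G →L[𝕜] F),
        spaceSzlenkIndex 𝕜 G ≤ ((ω ^ α : Ordinal.{u}) : WithTop Ordinal.{u}) ∧
        T = B.comp A := by
    intro E F _ _ _ _ _ _ T hT
    obtain ⟨γ, hγ, hTγ⟩ := exists_lt_szlenkIndex_le_omega0_opow
      (isCompact_image_adjoint_closedBall T) hα hT
    refine ⟨interpolationSpace T, inferInstance, inferInstance, inferInstance,
      interpolationSpace.lift T, interpolationSpace.incl T,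
      (spaceSzlenkIndex_interpolationSpace_le T hTγ).trans ?_,
      (interpolationSpace.incl_comp_lift T).symm⟩
    exact WithTop.coe_le_coe.2 (Ordinal.opow_le_opow_right Ordinal.omega0_pos
      (Order.add_one_le_of_lt hγ))
  refine ⟨fun E F _ _ _ _ _ _ T hT => ?_, key⟩
  obtain ⟨G, i₁, i₂, i₃, A, B, hG, hAB⟩ := key E F T hT
  exact ⟨G, i₁, i₂, i₃, A, B, operatorSzlenkIndex_id.trans_le hG, hAB⟩
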